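/- **The algorithm.** Let $n$ processes $p_1,\dots,p_n$ communicate through an array $\mathit{MEM}[1..n]$ of atomic single-writer multi-reader read/write registers, initially all $\bot$. Each process $p_i$ invokes the operation $\mathsf{write\_snapshot}(v_i)$ at most once, with an arbitrary value $v_i$ (several processes may have the same value), and then executes: 1. $\mathit{MEM}[i]\leftarrow\langle i,v_i\rangle$; 2. $new_i\leftarrow\bigcup_{1\le j\le n}\{\mathit{MEM}[j] : \mathit{MEM}[j]\ne\bot\}$; 3. **repeat** $old_i\leftarrow new_i$; 4. $\quad new_i\leftarrow\bigcup_{1\le j\le n}\{\mathit{MEM}[j] : \mathit{MEM}[j]\ne\bot\}$ 5. **until** $old_i=new_i$; 6. **return** $new_i$. The processes are asynchronous: their steps interleave arbitrarily, and a process may stop at any point. The $n$ reads of each collect (lines 2 and 4) are separate atomic steps, made in an arbitrary order. An *execution* $E$ of the algorithm is the sequence of the invocations and responses of $\mathsf{write\_snapshot}$ in a finite run. A response records the invocation that it answers and the returned set. **Interval-sequential executions.** An invoking (responding) concurrency class is a non-empty set of invocations (responses) by pairwise different processes. An *interval-sequential execution* is a finite, possibly empty, alternating sequence $I_0,R_0,I_1,R_1,\dots,I_m,R_m$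 of invoking classes $I_k$ and responding classes $R_k$ such that every $r\in R_k$ answers an invocation in some $I_j$ with $j\le k$, and the process of $r$ has no invocation in $I_{j+1},\dots,I_k$. **The write-snapshot object** is the following automaton. A state $q$ consists of a set $q.vals$ of id-value pairs and a set $q.pend$ of processes; both are empty in the initial state. From state $q$ with input an invoking class $I$, it may output a responding class $R$ and move to state $q'$ if and only if - for every $r\in R$, the process of $r$ is in $q.pend$ or has an invocation in $I$; - every $r\in R$ returns the set $q.vals\cup vals(I)$, where $vals(I)$ is the set of the id-value pairs $\langle i,x\rangle$ of the invocations $\mathsf{write\_snapshot}(x)$ by $p_i$ in $I$; - $q'.vals=q.vals\cup vals(I)$ and $q'.pend=(q.pend\cup ids(I))\setminus ids(R)$, where $ids(\cdot)$ denotes the set of processes of the events. An interval-sequential execution *of the object* is an interval-sequential execution $I_0,R_0,\dots,I_m,R_m$ that the automaton can consume and produce from its initial state. **Interval-linearizability.** An invocation in $E$ is pending if it has no matching response. An extension of $E$ is obtained by appending zero or more responses to pending invocations (at most one to each), and $comp(\cdot)$ removes the pending invocations. $E$ is *interval-linearizable* with respect to the write-snapshot object if there are an extension $\overline E$ of $E$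 and an interval-sequential execution $\widehat S$ of the object such that 1. for every process $p$, $comp(\overline E)$ and $\widehat S$ have the same projection at $p$ (the same sequence of events by $p$), and 2. whenever the response of an operation $a$ precedes the invocation of an operation $b$ in $comp(\overline E)$, every class of $\widehat S$ that contains the invocation or the response of $a$ comes before every class of $\widehat S$ that contains the invocation or the response of $b$. **Theorem.** Every execution of the write-snapshot algorithm is interval-linearizable with respect to the write-snapshot object. -/

import Mathlib

namespace IntervalLin

universe u v

/-! ### Interfaces and executions -/

/-- The interface of a concurrent object used by the processes `P`: its invocations, its responses,
the invoking process of an invocation, and the invocation that a response answers. -/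
structure Interface (P : Type u) where
  Inv : Type v
  Res : Type v
  invProc : Inv → P
  resInv : Res → Inv

/-- An event of an execution: an invocation or a response. -/
inductive Event {P : Type u} (𝓘 : Interface.{u, v} P) : Type v
  | inv (i : 𝓘.Inv) : Event 𝓘
  | res (r : 𝓘.Res) : Event 𝓘

section Generic

variable {P : Type u} {𝓘 : Interface.{u, v} P}

/-- The process that issues a response is the process of the invocation it answers. -/
def resProc (r : 𝓘.Res) : P := 𝓘.invProc (𝓘.resInv r)

/-- The process of an event. -/
def Event.proc : Event 𝓘 → P
  | .inv i => 𝓘.invProc i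
  | .res r => resProc r

/-! Executions are lists of pairwise distinct events, that is, totally ordered sets of events, so
that an event may be identified with its occurrence. -/

/-- The invocation `i` of `E` is pending: it has no matching response. -/
def Pending (E : List (Event 𝓘)) (i : 𝓘.Inv) : Prop :=
  Event.inv i ∈ E ∧ ∀ r : 𝓘.Res, Event.res r ∈ E → 𝓘.resInv r ≠ i

/-- `E'` is obtained from `E` by appending zero or more responses to pending invocations of `E`,
at most one to each of them. -/
def IsExtension (E E' : List (Event 𝓘)) : Prop :=
  ∃ L : List 𝓘.Res, E' = E ++ L.map Event.res ∧
    (∀ r ∈ L, Pending E (𝓘.resInv r)) ∧ (L.map 𝓘.resInv).Nodup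

open Classical in
/-- `comp E`: the sequence `E` without its pending invocations. -/
noncomputable def comp (E : List (Event 𝓘)) : List (Event 𝓘) :=
  E.filter (fun e => ∀ i : 𝓘.Inv, e = Event.inv i → ¬ Pending E i)

open Classical in
/-- The projection of an execution at a process `p`. -/
noncomputable def projExec (E : List (Event 𝓘)) (p : P) : List (Event 𝓘) :=
  E.filter (fun e => e.proc = p)

/-- The operation calls of `E`, each given by its response `r`: both the response `r` and the
invocation `𝓘.resInv r` that it answers occur in `E`. -/
def IsOpCall (E : List (Event 𝓘)) (r : 𝓘.Res) : Prop :=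
  Event.inv (𝓘.resInv r) ∈ E ∧ Event.res r ∈ E

/-- The real-time order on operation calls: the response of `a` appears in `E` before the
invocation of `b`. -/
def Precedes (E : List (Event 𝓘)) (a b : 𝓘.Res) : Prop :=
  List.Sublist [Event.res a, Event.inv (𝓘.resInv b)] E

/-! ### Interval-sequential executions and objects -/

/-- An invoking concurrency class: a non-empty set of invocations by pairwise different
processes. -/
def IsInvClass (I : Set 𝓘.Inv) : Prop :=
  I.Nonempty ∧ ∀ a ∈ I, ∀ b ∈ I, 𝓘.invProc a = 𝓘.invProc b → a = b

/-- A responding concurrency class: a non-empty set of responses to pairwise different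
processes. -/
def IsResClass (R : Set 𝓘.Res) : Prop :=
  R.Nonempty ∧ ∀ a ∈ R, ∀ b ∈ R, resProc a = resProc b → a = b

/-- An interval-sequential execution `I₀, R₀, I₁, R₁, …, I_m, R_m`, given as the list of the pairs
`(I_k, R_k)`. Every response in `R_k` answers an invocation in some `I_j`, `j ≤ k`, and its process
invokes nothing in `I_{j+1}, …, I_k`. -/
def IsIntervalSeq (h : List (Set 𝓘.Inv × Set 𝓘.Res)) : Prop :=
  (∀ c ∈ h, IsInvClass c.1 ∧ IsResClass c.2) ∧
  ∀ k : Fin h.length, ∀ r ∈ (h.get k).2, ∃ j ≤ k, 𝓘.resInv r ∈ (h.get j).1 ∧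
    ∀ j' : Fin h.length, j < j' → j' ≤ k → ∀ i ∈ (h.get j').1, 𝓘.invProc i ≠ resProc r

/-- The alternating sequence `I₀, R₀, I₁, R₁, …` of concurrency classes, as sets of events. -/
def classes (h : List (Set 𝓘.Inv × Set 𝓘.Res)) : List (Set (Event 𝓘)) :=
  h.flatMap (fun c => [Event.inv '' c.1, Event.res '' c.2])

open Classical in
/-- The projection of an interval-sequential execution at a process `p`: every class with an event
by `p` is replaced by the set of its events by `p` (a singleton), the others are removed. -/
noncomputable def projSeq (h : List (Set 𝓘.Inv × Set 𝓘.Res)) (p : P) : List (Set (Event 𝓘)) :=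
  ((classes h).map (fun C => {e ∈ C | e.proc = p})).filter (fun C => C.Nonempty)

/-- The operation call with response `r` appears in the class `C`: its invocation or its response
is in `C`. -/
def AppearsIn (r : 𝓘.Res) (C : Set (Event 𝓘)) : Prop :=
  Event.inv (𝓘.resInv r) ∈ C ∨ Event.res r ∈ C

/-- The order of the classes of `h` respects the real-time order of the operation calls of `E`. -/
def Respects (h : List (Set 𝓘.Inv × Set 𝓘.Res)) (E : List (Event 𝓘)) : Prop :=
  ∀ a b : 𝓘.Res, IsOpCall E a → IsOpCall E b → Precedes E a b →
    ∀ j k : Fin (classes h).length,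
      AppearsIn a ((classes h).get j) → AppearsIn b ((classes h).get k) → j < k

end Generic

/-- An interval-sequential object: a possibly non-deterministic Mealy machine whose inputs are
invoking concurrency classes and whose outputs are responding concurrency classes, such that the
output at a state determines the new state. -/
structure IntervalSeqObject {P : Type u} (𝓘 : Interface.{u, v} P) where
  State : Type v
  init : Set State
  δ : State → Set 𝓘.Inv → Set (Set 𝓘.Res × State)
  isInvClass : ∀ {q I R q'}, (R, q') ∈ δ q I → IsInvClass I
  isResClass : ∀ {q I R q'}, (R, q') ∈ δ q I → IsResClass R
  det : ∀ {q I R q' q''}, (R, q') ∈ δ q I → (R, q'') ∈ δ q I → q' = q''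

section Spec

variable {P : Type u} {𝓘 : Interface.{u, v} P}

/-- From state `q`, the machine can consume and produce `I₀, R₀, I₁, R₁, …, I_m, R_m`. -/
def IntervalSeqObject.Produces (X : IntervalSeqObject 𝓘) :
    X.State → List (Set 𝓘.Inv × Set 𝓘.Res) → Prop
  | _, [] => True
  | q, (I, R) :: h => ∃ q', (R, q') ∈ X.δ q I ∧ X.Produces q' h

/-- The interval-sequential specification of `X`: the set of its interval-sequential executions. -/
def IntervalSeqObject.ISSpec (X : IntervalSeqObject 𝓘) : Set (List (Set 𝓘.Inv × Set 𝓘.Res)) :=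
  {h | IsIntervalSeq h ∧ ∃ q₀ ∈ X.init, X.Produces q₀ h}

/-- An execution `E` of operations on `X` is interval-linearizable: some extension of `E` and some
interval-sequential execution `S` of `X` have the same projection at every process (after removal
of the pending invocations), and the order of `S` respects the real-time order of the operations. -/
def IntervalLinearizable (X : IntervalSeqObject 𝓘) (E : List (Event 𝓘)) : Prop :=
  ∃ (E' : List (Event 𝓘)) (S : List (Set 𝓘.Inv × Set 𝓘.Res)),
    IsExtension E E' ∧
    (∀ p : P, (projExec (comp E') p).map (fun e => {e}) = projSeq S p) ∧
    S ∈ X.ISSpec ∧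
    Respects S (comp E')

end Spec

/-! ### The write-snapshot object -/

/-- The interface of the write-snapshot object for the processes `Fin n` and proposed values in
`V`. An invocation is the pair of the invoking process and the proposed value, that is, the proposed
id-value pair. A response is the pair of the invocation it answers and the returned set of id-value
pairs. -/
abbrev wsInterface (n : ℕ) (V : Type v) : Interface.{0, v} (Fin n) where
  Inv := Fin n × V
  Res := (Fin n × V) × Set (Fin n × V)
  invProc := fun i => i.1
  resInv := fun r => r.1

/-- A state of the write-snapshot object: the id-value pairs proposed so far, and the processes with
pending invocations. -/
@[ext] structure WSState (n : ℕ) (V : Type v) where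
  vals : Set (Fin n × V)
  pend : Set (Fin n)

/-- The transitions of the write-snapshot object. The set of the id-value pairs proposed in `I` is
`I` itself. -/
def wsDelta (n : ℕ) (V : Type v) (q : WSState n V) (I : Set (wsInterface n V).Inv) :
    Set (Set (wsInterface n V).Res × WSState n V) :=
  {t | IsInvClass I ∧ IsResClass t.1 ∧
    (∀ r ∈ t.1, resProc r ∈ q.pend ∨ ∃ i ∈ I, (wsInterface n V).invProc i = resProc r) ∧
    (∀ r ∈ t.1, r.2 = q.vals ∪ I) ∧
    t.2.vals = q.vals ∪ I ∧
    t.2.pend = (q.pend ∪ (wsInterface n V).invProc '' I) \ (resProc '' t.1)}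

/-- The write-snapshot interval-sequential object. -/
def wsObject (n : ℕ) (V : Type v) : IntervalSeqObject (wsInterface n V) where
  State := WSState n V
  init := {⟨∅, ∅⟩}
  δ := wsDelta n V
  isInvClass := fun h => h.1
  isResClass := fun h => h.2.1
  det := by
    rintro q I R q' q'' ⟨-, -, -, -, h1, h2⟩ ⟨-, -, -, -, h3, h4⟩
    exact WSState.ext (h1.trans h3.symm) (h2.trans h4.symm)

/-! ### The write-snapshot algorithm

Shared memory: an array `MEM[1..n]` of single-writer multi-reader atomic registers, initially `⊥`.
Code of `write_snapshot(x)` for process `i`: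
```
(1)  MEM[i] ← (i, x)
(2)  new ← { MEM[j] : 1 ≤ j ≤ n, MEM[j] ≠ ⊥ }
(3)  repeat  old ← new
(4)          new ← { MEM[j] : 1 ≤ j ≤ n, MEM[j] ≠ ⊥ }
(5)  until old = new
(6)  return new
```
The `n` reads of a collect are separate atomic steps, performed in an arbitrary order, and the steps
of different processes interleave arbitrarily. A process invokes the operation at most once. -/

/-- The local state of a process. In a collect, `todo` is the set of the registers that are still to
be read and `new` is the set of the non-`⊥` values read so far. -/
inductive LocalState (n : ℕ) (V : Type v) : Type v
  /-- the operation has not been invoked -/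
  | idle : LocalState n V
  /-- before the write of line 1 -/
  | writing (x : V) : LocalState n V
  /-- in the collect of line 2 -/
  | firstCollect (x : V) (todo : Finset (Fin n)) (new : Set (Fin n × V)) : LocalState n V
  /-- in the collect of line 4 -/
  | loopCollect (x : V) (old : Set (Fin n × V)) (todo : Finset (Fin n)) (new : Set (Fin n × V)) :
      LocalState n V
  /-- before the return of line 6 -/
  | returning (x : V) (new : Set (Fin n × V)) : LocalState n V
  /-- the operation has returned -/
  | done : LocalState n V

/-- A configuration: the contents of the registers (`none` is `⊥`) and the local states. -/
structure Config (n : ℕ) (V : Type v) where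
  mem : Fin n → Option (Fin n × V)
  loc : Fin n → LocalState n V

/-- The initial configuration. -/
def Config.initial (n : ℕ) (V : Type v) : Config n V where
  mem := fun _ => none
  loc := fun _ => .idle

/-- Replace the local state of process `i`. -/
def Config.setLoc {n : ℕ} {V : Type v} (c : Config n V) (i : Fin n) (s : LocalState n V) :
    Config n V where
  mem := c.mem
  loc := Function.update c.loc i s

/-- Write the value `a` into register `i`. -/
def Config.write {n : ℕ} {V : Type v} (c : Config n V) (i : Fin n) (a : Fin n × V) :
    Config n V where
  mem := Function.update c.mem i (some a)
  loc := c.loc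

/-- The steps of the algorithm. The label is the invocation or response of the write-snapshot
operation that the step performs, or `none` for an internal step. -/
inductive Step {n : ℕ} {V : Type v} :
    Config n V → Option (Event (wsInterface n V)) → Config n V → Prop
  | invoke (c : Config n V) (i : Fin n) (x : V) : c.loc i = .idle →
      Step c (some (.inv (i, x))) (c.setLoc i (.writing x))
  | write (c : Config n V) (i : Fin n) (x : V) : c.loc i = .writing x →
      Step c none ((c.write i (i, x)).setLoc i (.firstCollect x Finset.univ ∅))
  | firstRead (c : Config n V) (i : Fin n) (x : V) (todo : Finset (Fin n)) (new : Set (Fin n × V))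
      (j : Fin n) : c.loc i = .firstCollect x todo new → j ∈ todo →
      Step c none (c.setLoc i (.firstCollect x (todo.erase j) (new ∪ {a | c.mem j = some a})))
  | enterLoop (c : Config n V) (i : Fin n) (x : V) (new : Set (Fin n × V)) :
      c.loc i = .firstCollect x ∅ new →
      Step c none (c.setLoc i (.loopCollect x new Finset.univ ∅))
  | loopRead (c : Config n V) (i : Fin n) (x : V) (old : Set (Fin n × V)) (todo : Finset (Fin n))
      (new : Set (Fin n × V)) (j : Fin n) : c.loc i = .loopCollect x old todo new → j ∈ todo →
      Step c none (c.setLoc i (.loopCollect x old (todo.erase j) (new ∪ {a | c.mem j = some a})))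
  | repeatLoop (c : Config n V) (i : Fin n) (x : V) (old new : Set (Fin n × V)) :
      c.loc i = .loopCollect x old ∅ new → old ≠ new →
      Step c none (c.setLoc i (.loopCollect x new Finset.univ ∅))
  | exitLoop (c : Config n V) (i : Fin n) (x : V) (old new : Set (Fin n × V)) :
      c.loc i = .loopCollect x old ∅ new → old = new →
      Step c none (c.setLoc i (.returning x new))
  | respond (c : Config n V) (i : Fin n) (x : V) (new : Set (Fin n × V)) :
      c.loc i = .returning x new →
      Step c (some (.res ((i, x), new))) (c.setLoc i .done)

/-- `Run E c`: some finite sequence of steps leads from the initial configuration to `c`, and `E` is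
its sequence of invocations and responses of the write-snapshot operation. -/
inductive Run {n : ℕ} {V : Type v} : List (Event (wsInterface n V)) → Config n V → Prop
  | start : Run [] (Config.initial n V)
  | step {E : List (Event (wsInterface n V))} {c c' : Config n V}
      {e : Option (Event (wsInterface n V))} :
      Run E c → Step c e c' → Run (E ++ e.toList) c'

/-- `E` is an execution of the write-snapshot algorithm. -/
def IsExecution (n : ℕ) (V : Type v) (E : List (Event (wsInterface n V))) : Prop :=
  ∃ c : Config n V, Run E c

end IntervalLin

namespace IntervalLin

universe u v

/-! ### Lists and projections -/

/-! Each register is written at most once, so the memory contents only grow, and the contents at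
different instants form a chain under inclusion. A loop collect that starts with contents `M`
re-reads every pair of `M`, while `old` contains only pairs already in memory at that start. At
exit, `M ⊆ new = old ⊆ M`, so a returned set is exactly the memory at one instant of the run.
`RunInvariant` carries this by recording in `H` the contents at the starts of loop collects. It
follows (`RunInvariant.snapshotReturns`) that returned sets are ordered by inclusion, contain the
caller's own pair, contain only invoked pairs, and miss every pair invoked after the return.

These properties alone give interval-linearizability. Let `W 0 ⊂ W 1 ⊂ …` be the distinct returned
sets. The invoking class `I_k` consists of the pairs of `W k` that are in no earlier set, and `R_k`
of the responses returning `W k`; the object's value set after step `k` is then `W k`. An operation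
is thus open from the level at which its pair first appears to the level of the set it returns. A
pending operation whose pair was seen is completed with the largest returned set; the other pending
operations are removed (`SnapshotReturns.exists_returnsChain`). If `a` returns `W k` before `b` is
invoked, the pair of `b` is not in `W k`, so `b` starts at a later level (`ReturnsChain.respects`).
-/

theorem filter_eq_pair_of_getElem {α : Type*} (l : List α) (q : α → Bool) (a b : ℕ) (hab : a < b)
    (hb : b < l.length) (h : ∀ (c : ℕ) (hc : c < l.length), q l[c] = true ↔ c = a ∨ c = b) :
    l.filter q = [l[a], l[b]] := by
  have hd : l = l.take a ++ l[a] :: ((l.drop (a + 1)).take (b - (a + 1)) ++ l[b] ::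
      l.drop (b + 1)) := by
    apply List.ext_getElem
    · simp; omega
    · intro c hc hc'
      grind
  have h1 : (l.take a).filter q = [] := by
    rw [List.filter_eq_nil_iff]
    intro x hx
    obtain ⟨c, hc, rfl⟩ := List.getElem_of_mem hx
    grind
  have h2 : ((l.drop (a + 1)).take (b - (a + 1))).filter q = [] := by
    rw [List.filter_eq_nil_iff]
    intro x hx
    obtain ⟨c, hc, rfl⟩ := List.getElem_of_mem hx
    grind
  have h3 : (l.drop (b + 1)).filter q = [] := by
    rw [List.filter_eq_nil_iff]
    intro x hx
    obtain ⟨c, hc, rfl⟩ := List.getElem_of_mem hx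
    grind
  have ha : q l[a] = true := (h a (by omega)).2 (.inl rfl)
  have hb' : q l[b] = true := (h b hb).2 (.inr rfl)
  conv_lhs => rw [hd]
  simp only [List.filter_append, List.filter_cons, h1, h2, h3, ha, hb']
  simp

section Generic

variable {P : Type u} {𝓘 : Interface.{u, v} P}

theorem projExec_append (E F : List (Event 𝓘)) (p : P) :
    projExec (E ++ F) p = projExec E p ++ projExec F p := by
  simp [projExec]

theorem projExec_singleton_self (e : Event 𝓘) : projExec [e] e.proc = [e] := by
  simp [projExec]

theorem projExec_singleton_of_ne {e : Event 𝓘} {p : P} (h : e.proc ≠ p) : projExec [e] p = [] := by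
  simp [projExec, h]

theorem mem_projExec {E : List (Event 𝓘)} {p : P} {e : Event 𝓘} :
    e ∈ projExec E p ↔ e ∈ E ∧ e.proc = p := by
  simp [projExec]

open Classical in
theorem projExec_comp_comm (E : List (Event 𝓘)) (p : P) :
    projExec (comp E) p =
      (projExec E p).filter (fun e => decide (∀ i : 𝓘.Inv, e = Event.inv i → ¬ Pending E i)) := by
  simp only [projExec, comp]
  rw [List.filter_comm]

theorem mem_comp {E : List (Event 𝓘)} {e : Event 𝓘} :
    e ∈ comp E ↔ e ∈ E ∧ ∀ i : 𝓘.Inv, e = Event.inv i → ¬ Pending E i := by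
  simp only [comp, List.mem_filter, decide_eq_true_eq]

/-! ### Positions of events in the alternating sequence of classes -/

theorem length_classes (h : List (Set 𝓘.Inv × Set 𝓘.Res)) :
    (classes h).length = 2 * h.length := by
  induction h with
  | nil => rfl
  | cons c h ih =>
    simp only [classes, List.flatMap_cons, List.length_append, List.length_cons] at ih ⊢
    simp only [List.length_nil]
    omega

theorem getElem_classes_inv (h : List (Set 𝓘.Inv × Set 𝓘.Res)) (k : ℕ) (hk : k < h.length) :
    (classes h)[2 * k]'(by rw [length_classes]; omega) = Event.inv '' h[k].1 := by
  induction h generalizing k with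
  | nil => simp at hk
  | cons c h ih =>
    cases k with
    | zero => rfl
    | succ k => exact ih k (by simpa using hk)

theorem getElem_classes_res (h : List (Set 𝓘.Inv × Set 𝓘.Res)) (k : ℕ) (hk : k < h.length) :
    (classes h)[2 * k + 1]'(by rw [length_classes]; omega) = Event.res '' h[k].2 := by
  induction h generalizing k with
  | nil => simp at hk
  | cons c h ih =>
    cases k with
    | zero => rfl
    | succ k => exact ih k (by simpa using hk)

/-- Parity separates the two kinds of classes: invocations sit at even positions, responses at odd
ones. -/
theorem inv_mem_classes_iff (h : List (Set 𝓘.Inv × Set 𝓘.Res)) (c : ℕ)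
    (hc : c < (classes h).length) (i : 𝓘.Inv) :
    Event.inv i ∈ (classes h)[c] ↔ ∃ (k : ℕ) (hk : k < h.length), c = 2 * k ∧ i ∈ h[k].1 := by
  have hl := length_classes h
  rcases Nat.even_or_odd' c with ⟨k, rfl | rfl⟩
  · rw [getElem_classes_inv h k (by omega)]
    constructor
    · rintro ⟨j, hj, he⟩
      cases he
      exact ⟨k, by omega, rfl, hj⟩
    · rintro ⟨k', hk', he, hi⟩
      obtain rfl : k = k' := by omega
      exact ⟨i, hi, rfl⟩
  · rw [getElem_classes_res h k (by omega)]
    constructor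
    · rintro ⟨j, hj, he⟩
      cases he
    · rintro ⟨k', hk', he, hi⟩
      omega

theorem res_mem_classes_iff (h : List (Set 𝓘.Inv × Set 𝓘.Res)) (c : ℕ)
    (hc : c < (classes h).length) (r : 𝓘.Res) :
    Event.res r ∈ (classes h)[c] ↔ ∃ (k : ℕ) (hk : k < h.length), c = 2 * k + 1 ∧ r ∈ h[k].2 := by
  have hl := length_classes h
  rcases Nat.even_or_odd' c with ⟨k, rfl | rfl⟩
  · rw [getElem_classes_inv h k (by omega)]
    constructor
    · rintro ⟨j, hj, he⟩
      cases he
    · rintro ⟨k', hk', he, hi⟩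
      omega
  · rw [getElem_classes_res h k (by omega)]
    constructor
    · rintro ⟨j, hj, he⟩
      cases he
      exact ⟨k, by omega, rfl, hj⟩
    · rintro ⟨k', hk', he, hi⟩
      obtain rfl : k = k' := by omega
      exact ⟨r, hi, rfl⟩

theorem projSeq_eq_nil {h : List (Set 𝓘.Inv × Set 𝓘.Res)} {p : P}
    (hI : ∀ (k : ℕ) (hk : k < h.length), ∀ i ∈ h[k].1, 𝓘.invProc i ≠ p)
    (hR : ∀ (k : ℕ) (hk : k < h.length), ∀ r ∈ h[k].2, resProc r ≠ p) :
    projSeq h p = [] := by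
  unfold projSeq
  rw [List.filter_eq_nil_iff]
  intro C hC
  obtain ⟨c, hc, rfl⟩ := List.getElem_of_mem hC
  simp only [List.getElem_map, decide_eq_true_eq]
  rintro ⟨e | e, he, hp⟩
  · obtain ⟨k, hk, -, hi⟩ := (inv_mem_classes_iff h c _ e).1 he
    exact hI k hk e hi hp
  · obtain ⟨k, hk, -, hi⟩ := (res_mem_classes_iff h c _ e).1 he
    exact hR k hk e hi hp

/-- Only positions `2 * j` and `2 * k + 1` meet `p`; `j ≤ k` puts the invocation first. -/
theorem projSeq_eq_pair {h : List (Set 𝓘.Inv × Set 𝓘.Res)} {p : P} {i : 𝓘.Inv} {r : 𝓘.Res}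
    {j k : ℕ} (hjk : j ≤ k) (hkl : k < h.length) (hi : 𝓘.invProc i = p) (hr : resProc r = p)
    (hI : ∀ (k' : ℕ) (hk : k' < h.length) (i' : 𝓘.Inv), 𝓘.invProc i' = p →
      (i' ∈ h[k'].1 ↔ k' = j ∧ i' = i))
    (hR : ∀ (k' : ℕ) (hk : k' < h.length) (r' : 𝓘.Res), resProc r' = p →
      (r' ∈ h[k'].2 ↔ k' = k ∧ r' = r)) :
    projSeq h p = [{Event.inv i}, {Event.res r}] := by
  have hl := length_classes h
  unfold projSeq
  rw [filter_eq_pair_of_getElem _ _ (2 * j) (2 * k + 1) (by omega)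
    (by rw [List.length_map]; omega)]
  · simp only [List.getElem_map]
    congr 1
    · ext e
      rw [Set.mem_singleton_iff]
      constructor
      · rintro ⟨he, hp⟩
        cases e with
        | inv i' =>
          obtain ⟨k', hk', -, hi'⟩ := (inv_mem_classes_iff h _ _ i').1 he
          rw [((hI k' hk' i' hp).1 hi').2]
        | res r' =>
          obtain ⟨k', hk', h', hi'⟩ := (res_mem_classes_iff h _ _ r').1 he
          omega
      · rintro rfl
        exact ⟨(inv_mem_classes_iff h _ _ i).2 ⟨j, by omega, rfl,
          (hI j (by omega) i hi).2 ⟨rfl, rfl⟩⟩, hi⟩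
    · congr 1
      ext e
      rw [Set.mem_singleton_iff]
      constructor
      · rintro ⟨he, hp⟩
        cases e with
        | inv i' =>
          obtain ⟨k', hk', h', hi'⟩ := (inv_mem_classes_iff h _ _ i').1 he
          omega
        | res r' =>
          obtain ⟨k', hk', -, hi'⟩ := (res_mem_classes_iff h _ _ r').1 he
          rw [((hR k' hk' r' hp).1 hi').2]
      · rintro rfl
        exact ⟨(res_mem_classes_iff h _ _ r).2 ⟨k, by omega, rfl,
          (hR k (by omega) r hr).2 ⟨rfl, rfl⟩⟩, hr⟩
  · intro c hc
    simp only [List.getElem_map, decide_eq_true_eq]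
    constructor
    · rintro ⟨e | e, he, hp⟩
      · obtain ⟨k', hk', rfl, hi'⟩ := (inv_mem_classes_iff h _ _ e).1 he
        exact .inl (by rw [((hI k' hk' e hp).1 hi').1])
      · obtain ⟨k', hk', rfl, hi'⟩ := (res_mem_classes_iff h _ _ e).1 he
        exact .inr (by rw [((hR k' hk' e hp).1 hi').1])
    · rintro (rfl | rfl)
      · exact ⟨_, (inv_mem_classes_iff h _ _ i).2 ⟨j, by omega, rfl,
          (hI j (by omega) i hi).2 ⟨rfl, rfl⟩⟩, hi⟩
      · exact ⟨_, (res_mem_classes_iff h _ _ r).2 ⟨k, by omega, rfl,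
          (hR k (by omega) r hr).2 ⟨rfl, rfl⟩⟩, hr⟩

/-- Naming all the states in advance replaces the recursion of `Produces` by one condition per
index. -/
theorem IntervalSeqObject.produces_of_states (X : IntervalSeqObject 𝓘)
    (h : List (Set 𝓘.Inv × Set 𝓘.Res)) (s : ℕ → X.State)
    (hs : ∀ (k : ℕ) (hk : k < h.length), (h[k].2, s (k + 1)) ∈ X.δ (s k) h[k].1) :
    X.Produces (s 0) h := by
  induction h generalizing s with
  | nil => trivial
  | cons c h ih =>
    exact ⟨s 1, hs 0 (by simp), ih (fun k => s (k + 1)) fun k hk => hs (k + 1) (by simpa using hk)⟩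

end Generic

/-! ### Enumeration of a finite chain -/

theorem exists_strictMono_enumeration {α : Type*} [PartialOrder α] {T : Set α} (hT : T.Finite)
    (hc : IsChain (· ≤ ·) T) : ∃ (m : ℕ) (f : Fin m → α), StrictMono f ∧ Set.range f = T := by
  have : Fintype T := hT.fintype
  let _ : LinearOrder T :=
    { (inferInstance : PartialOrder T) with
      le_total := fun a b => hc.total a.2 b.2
      toDecidableLE := Classical.decRel _ }
  let e := Fintype.orderIsoFinOfCardEq T rfl
  refine ⟨_, fun k => (e k : α), fun a b hab => e.strictMono hab, ?_⟩
  ext x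
  constructor
  · rintro ⟨k, rfl⟩
    exact (e k).2
  · intro hx
    exact ⟨e.symm ⟨x, hx⟩, by simp⟩

section WriteSnapshot

variable {n : ℕ} {V : Type v}

/-! ### Executions whose projections are single operation calls -/

/-- Every process invokes at most once and, after its invocation, responds at most once. -/
def OneShot (E : List (Event (wsInterface n V))) : Prop :=
  ∀ p, projExec E p = [] ∨ (∃ x, projExec E p = [.inv (p, x)]) ∨
    ∃ x S, projExec E p = [.inv (p, x), .res ((p, x), S)]

theorem OneShot.inv_unique {E : List (Event (wsInterface n V))} (h : OneShot E) {a b : Fin n × V}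
    (ha : Event.inv a ∈ E) (hb : Event.inv b ∈ E) (hab : a.1 = b.1) : a = b := by
  have ha' : (Event.inv a : Event (wsInterface n V)) ∈ projExec E a.1 := mem_projExec.2 ⟨ha, rfl⟩
  have hb' : (Event.inv b : Event (wsInterface n V)) ∈ projExec E a.1 :=
    mem_projExec.2 ⟨hb, hab.symm⟩
  rcases h a.1 with h | ⟨x, h⟩ | ⟨x, S, h⟩ <;> rw [h] at ha' hb' <;> simp at ha' hb'
  · rw [ha', hb']
  · rw [ha', hb']

theorem OneShot.res_unique {E : List (Event (wsInterface n V))} (h : OneShot E)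
    {r s : (wsInterface n V).Res} (hr : Event.res r ∈ E) (hs : Event.res s ∈ E)
    (hrs : r.1.1 = s.1.1) : r = s := by
  have hr' : (Event.res r : Event (wsInterface n V)) ∈ projExec E r.1.1 := mem_projExec.2 ⟨hr, rfl⟩
  have hs' : (Event.res s : Event (wsInterface n V)) ∈ projExec E r.1.1 :=
    mem_projExec.2 ⟨hs, hrs.symm⟩
  rcases h r.1.1 with h | ⟨x, h⟩ | ⟨x, S, h⟩ <;> rw [h] at hr' hs' <;> simp at hr' hs'
  rw [hr', hs']

theorem OneShot.inv_mem {E : List (Event (wsInterface n V))} (h : OneShot E)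
    {r : (wsInterface n V).Res} (hr : Event.res r ∈ E) : Event.inv r.1 ∈ E := by
  have hr' : (Event.res r : Event (wsInterface n V)) ∈ projExec E r.1.1 := mem_projExec.2 ⟨hr, rfl⟩
  suffices (Event.inv r.1 : Event (wsInterface n V)) ∈ projExec E r.1.1 from (mem_projExec.1 this).1
  rcases h r.1.1 with h | ⟨x, h⟩ | ⟨x, S, h⟩ <;> rw [h] at hr' ⊢ <;> simp at hr' ⊢
  rw [hr']

theorem OneShot.projExec_eq_pair {E : List (Event (wsInterface n V))} (h : OneShot E)
    {r : (wsInterface n V).Res} (hr : Event.res r ∈ E) :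
    projExec E r.1.1 = [.inv r.1, .res r] := by
  have hr' : (Event.res r : Event (wsInterface n V)) ∈ projExec E r.1.1 := mem_projExec.2 ⟨hr, rfl⟩
  rcases h r.1.1 with h | ⟨x, h⟩ | ⟨x, S, h⟩ <;> rw [h] at hr' ⊢ <;> simp at hr' ⊢
  rw [hr']
  exact ⟨rfl, rfl⟩

open Classical in
theorem projExec_comp_of_res_mem {E : List (Event (wsInterface n V))} (h : OneShot E)
    {r : (wsInterface n V).Res} (hr : Event.res r ∈ E) :
    projExec (comp E) r.1.1 = [.inv r.1, .res r] := by
  rw [projExec_comp_comm, h.projExec_eq_pair hr, List.filter_eq_self]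
  intro e he
  refine decide_eq_true ?_
  rintro i rfl ⟨-, hi⟩
  simp at he
  subst he
  exact hi r hr rfl

/-- Without a response by `p`, every invocation by `p` is pending and is removed. -/
theorem projExec_comp_of_forall_res {E : List (Event (wsInterface n V))} {p : Fin n}
    (hr : ∀ r : (wsInterface n V).Res, Event.res r ∈ E → r.1.1 ≠ p) :
    projExec (comp E) p = [] := by
  rw [List.eq_nil_iff_forall_not_mem]
  intro e hep
  obtain ⟨hec, rfl⟩ := mem_projExec.1 hep
  obtain ⟨he, hp⟩ := mem_comp.1 hec
  cases e with
  | inv i => exact hp i rfl ⟨he, fun r h1 h2 => hr r h1 (congrArg Prod.fst h2)⟩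
  | res r => exact hr r he rfl

/-! ### Linearizing an execution by the chain of the returned sets -/

/-- The interval-sequential execution given by a chain `W` of sets of pairs and the responses of
`E`: the `k`-th classes are the pairs that are new in `W k` and the responses that return `W k`. -/
def chainSeq (E : List (Event (wsInterface n V))) {m : ℕ} (W : Fin m → Set (Fin n × V)) :
    List (Set (wsInterface n V).Inv × Set (wsInterface n V).Res) :=
  List.ofFn fun k => ({a | a ∈ W k ∧ ∀ j < k, a ∉ W j}, {r | Event.res r ∈ E ∧ r.2 = W k})

/-- The state of the write-snapshot object after `k` steps of `chainSeq E W`. -/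
def chainState (E : List (Event (wsInterface n V))) {m : ℕ} (W : Fin m → Set (Fin n × V)) (k : ℕ) :
    WSState n V where
  vals := {a | ∃ j : Fin m, j.val < k ∧ a ∈ W j}
  pend := {p | (∃ j : Fin m, j.val < k ∧ ∃ a ∈ W j, a.1 = p) ∧
    ∀ j : Fin m, j.val < k → ∀ r : (wsInterface n V).Res, Event.res r ∈ E → r.2 = W j → r.1.1 ≠ p}

/-- `W` enumerates in increasing order the sets returned in `E`, every operation returns a set with
its own pair, and every pair in a returned set belongs to an operation call. -/
structure ReturnsChain (E : List (Event (wsInterface n V))) {m : ℕ} (W : Fin m → Set (Fin n × V)) :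
    Prop where
  oneShot : OneShot E
  strictMono : StrictMono W
  exists_res : ∀ k, ∃ r : (wsInterface n V).Res, Event.res r ∈ E ∧ r.2 = W k
  exists_eq : ∀ r : (wsInterface n V).Res, Event.res r ∈ E → ∃ k, r.2 = W k
  self_mem : ∀ r : (wsInterface n V).Res, Event.res r ∈ E → r.1 ∈ r.2
  complete : ∀ k, ∀ a ∈ W k, ∃ r : (wsInterface n V).Res, Event.res r ∈ E ∧ r.1 = a
  not_mem_of_precedes : ∀ r s : (wsInterface n V).Res, Precedes E r s → s.1 ∉ r.2

namespace ReturnsChain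

variable {E : List (Event (wsInterface n V))} {m : ℕ} {W : Fin m → Set (Fin n × V)}

theorem inv_mem (h : ReturnsChain E W) {k : Fin m} {a : Fin n × V} (ha : a ∈ W k) :
    Event.inv a ∈ E := by
  obtain ⟨r, hr, rfl⟩ := h.complete k a ha
  exact h.oneShot.inv_mem hr

/-- This makes the invocations in a class have pairwise different processes, and prevents a process
from entering the chain at two levels. -/
theorem eq_of_proc_eq (h : ReturnsChain E W) {j k : Fin m} {a b : Fin n × V} (ha : a ∈ W j)
    (hb : b ∈ W k) (hab : a.1 = b.1) : a = b :=
  h.oneShot.inv_unique (h.inv_mem ha) (h.inv_mem hb) hab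

/-- The level found here is the index of the invoking class that contains `a`. -/
theorem exists_first {k : Fin m} {a : Fin n × V} (ha : a ∈ W k) :
    ∃ j ≤ k, a ∈ W j ∧ ∀ j' < j, a ∉ W j' := by
  induction k using WellFoundedLT.induction with
  | ind k ih =>
    by_cases hk : ∃ j < k, a ∈ W j
    · obtain ⟨j, hj, haj⟩ := hk
      obtain ⟨i, hi, h1, h2⟩ := ih j hj haj
      exact ⟨i, hi.trans hj.le, h1, h2⟩
    · exact ⟨k, le_rfl, ha, fun j hj haj => hk ⟨j, hj, haj⟩⟩

theorem isInvClass (h : ReturnsChain E W) (k : Fin m) :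
    IsInvClass (𝓘 := wsInterface n V) {a | a ∈ W k ∧ ∀ j < k, a ∉ W j} := by
  refine ⟨?_, fun a ha b hb hab => h.eq_of_proc_eq ha.1 hb.1 hab⟩
  -- The bottom set has no predecessor, so its nonemptiness comes from the own pair of an operation
  -- that returns it. Above it, a pair outside the preceding set exists by strictness.
  by_cases hk : k.val = 0
  · obtain ⟨r, hr, hrk⟩ := h.exists_res k
    exact ⟨r.1, hrk ▸ h.self_mem r hr, fun j hj => by have := Fin.lt_def.1 hj; omega⟩
  · let i : Fin m := ⟨k.val - 1, by omega⟩
    have hik : i < k := Fin.lt_def.2 (by simp only [i]; omega)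
    obtain ⟨a, ha, hai⟩ := Set.exists_of_ssubset (h.strictMono hik)
    refine ⟨a, ha, fun j hj haj => hai (h.strictMono.monotone (Fin.le_def.2 ?_) haj)⟩
    have := Fin.lt_def.1 hj
    simp only [i]; omega

theorem isResClass (h : ReturnsChain E W) (k : Fin m) :
    IsResClass (𝓘 := wsInterface n V) {r | Event.res r ∈ E ∧ r.2 = W k} :=
  ⟨h.exists_res k, fun _ ha _ hb hab => h.oneShot.res_unique ha.1 hb.1 hab⟩

theorem isIntervalSeq (h : ReturnsChain E W) : IsIntervalSeq (chainSeq E W) := by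
  have hl : (chainSeq E W).length = m := by simp [chainSeq]
  constructor
  · intro c hc
    obtain ⟨k, rfl⟩ := (List.mem_ofFn' _ _).1 hc
    exact ⟨h.isInvClass k, h.isResClass k⟩
  · rintro ⟨k, hk⟩ r hr
    change r ∈ (chainSeq E W)[k].2 at hr
    simp only [chainSeq, List.getElem_ofFn] at hr
    have hm : r.1 ∈ W ⟨k, hl ▸ hk⟩ := hr.2 ▸ h.self_mem r hr.1
    obtain ⟨j, hjk, hj, hj'⟩ := exists_first hm
    refine ⟨⟨j, hl.symm ▸ j.2⟩, hjk, ?_, ?_⟩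
    · change r.1 ∈ ((chainSeq E W)[j.val]'(hl.symm ▸ j.2)).1
      simp only [chainSeq, List.getElem_ofFn]
      exact ⟨hj, hj'⟩
    · rintro ⟨j', hj'm⟩ hjj' hj'k i hi hir
      change i ∈ (chainSeq E W)[j'].1 at hi
      simp only [chainSeq, List.getElem_ofFn] at hi
      have : i = r.1 := h.eq_of_proc_eq hi.1 hj hir
      exact hi.2 j (Fin.lt_def.2 (Fin.lt_def.1 hjj')) (this ▸ hj)

theorem vals_union (h : ReturnsChain E W) (k : ℕ) (hk : k < m) :
    {a | ∃ j : Fin m, j.val < k ∧ a ∈ W j} ∪ {a | a ∈ W ⟨k, hk⟩ ∧ ∀ j < ⟨k, hk⟩, a ∉ W j}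
      = W ⟨k, hk⟩ := by
  ext a
  constructor
  · rintro (⟨j, hj, ha⟩ | ⟨ha, -⟩)
    · exact h.strictMono.monotone (Fin.le_def.2 hj.le) ha
    · exact ha
  · intro ha
    by_cases hex : ∃ j : Fin m, j.val < k ∧ a ∈ W j
    · exact .inl hex
    · exact .inr ⟨ha, fun j hj haj => hex ⟨j, hj, haj⟩⟩

/-- A response at level `k` contains its own pair, which is therefore either new at this level or
from an earlier one. In the latter case the process is still pending, because its only response is
the one at level `k`. -/
theorem transition (h : ReturnsChain E W) (k : ℕ) (hk : k < m) :
    ({r : (wsInterface n V).Res | Event.res r ∈ E ∧ r.2 = W ⟨k, hk⟩}, chainState E W (k + 1)) ∈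
      wsDelta n V (chainState E W k) {a | a ∈ W ⟨k, hk⟩ ∧ ∀ j < ⟨k, hk⟩, a ∉ W j} := by
  have hv := h.vals_union k hk
  refine ⟨h.isInvClass _, h.isResClass _, ?_, fun r hr => hr.2.trans hv.symm, ?_, ?_⟩
  · rintro r ⟨hr, hrk⟩
    have hm : r.1 ∈ W ⟨k, hk⟩ := hrk ▸ h.self_mem r hr
    rw [← hv] at hm
    rcases hm with ⟨j, hj, ha⟩ | ha
    · refine .inl ⟨⟨j, hj, r.1, ha, rfl⟩, fun j' hj' s hs hsj hsr => ?_⟩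
      have : s = r := h.oneShot.res_unique hs hr hsr
      subst this
      have := h.strictMono.injective (hsj.symm.trans hrk)
      simp [this] at hj'
    · exact .inr ⟨r.1, ha, rfl⟩
  · refine Eq.trans ?_ hv.symm
    ext a
    constructor
    · rintro ⟨j, hj, ha⟩
      exact h.strictMono.monotone (Fin.le_def.2 (Nat.lt_succ_iff.1 hj)) ha
    · exact fun ha => ⟨_, Nat.lt_succ_self k, ha⟩
  · ext p
    constructor
    · rintro ⟨⟨j, hj, a, ha, rfl⟩, hp⟩
      refine ⟨?_, ?_⟩
      · have ha' : a ∈ W ⟨k, hk⟩ :=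
          h.strictMono.monotone (Fin.le_def.2 (Nat.lt_succ_iff.1 hj)) ha
        rw [← hv] at ha'
        rcases ha' with ⟨j', hj', ha'⟩ | ha'
        · exact .inl ⟨⟨j', hj', a, ha', rfl⟩, fun i hi => hp i (Nat.lt_succ_of_lt hi)⟩
        · exact .inr ⟨a, ha', rfl⟩
      · rintro ⟨r, hr, hra⟩
        exact hp ⟨k, hk⟩ (Nat.lt_succ_self k) r hr.1 hr.2 hra
    · rintro ⟨hp, hpr⟩
      have hpr' : ∀ r : (wsInterface n V).Res, Event.res r ∈ E → r.2 = W ⟨k, hk⟩ → r.1.1 ≠ p :=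
        fun r h1 h2 h3 => hpr ⟨r, ⟨h1, h2⟩, h3⟩
      rcases hp with ⟨⟨j, hj, a, ha, rfl⟩, hp⟩ | ⟨a, ha, rfl⟩
      · refine ⟨⟨j, Nat.lt_succ_of_lt hj, a, ha, rfl⟩, fun i hi => ?_⟩
        rcases Nat.lt_succ_iff_lt_or_eq.1 hi with hi | hi
        · exact hp i hi
        · obtain rfl : i = ⟨k, hk⟩ := Fin.ext hi
          exact hpr'
      · refine ⟨⟨_, Nat.lt_succ_self k, a, ha.1, rfl⟩, fun i hi r hr hri hra => ?_⟩
        rcases Nat.lt_succ_iff_lt_or_eq.1 hi with hi | hi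
        -- A process whose pair is new at level `k` cannot have responded earlier: the earlier
        -- returned set would already contain its pair.
        · have hm : r.1 ∈ W i := hri ▸ h.self_mem r hr
          have : r.1 = a := h.eq_of_proc_eq hm ha.1 hra
          exact ha.2 i hi (this ▸ hm)
        · obtain rfl : i = ⟨k, hk⟩ := Fin.ext hi
          exact hpr' r hr hri hra

theorem mem_ISSpec (h : ReturnsChain E W) : chainSeq E W ∈ (wsObject n V).ISSpec := by
  refine ⟨h.isIntervalSeq, chainState E W 0, ?_, ?_⟩
  · refine WSState.ext ?_ ?_
    · ext a
      simp [chainState]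
    · ext p
      simp [chainState]
  · refine (wsObject n V).produces_of_states _ (chainState E W) fun k hk => ?_
    have hk' : k < m := by simpa [chainSeq] using hk
    simp only [chainSeq, List.getElem_ofFn]
    exact h.transition k hk'

theorem projSeq_eq (h : ReturnsChain E W) (p : Fin n) :
    (projExec (comp E) p).map (fun e => {e}) = projSeq (chainSeq E W) p := by
  have hl : (chainSeq E W).length = m := by simp [chainSeq]
  by_cases hp : ∃ r : (wsInterface n V).Res, Event.res r ∈ E ∧ r.1.1 = p
  · obtain ⟨r, hr, rfl⟩ := hp
    obtain ⟨k, hrk⟩ := h.exists_eq r hr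
    obtain ⟨j, hjk, hj, hj'⟩ := exists_first (hrk ▸ h.self_mem r hr)
    rw [projExec_comp_of_res_mem h.oneShot hr]
    symm
    have hkl : k.val < (chainSeq E W).length := hl.symm ▸ k.2
    refine projSeq_eq_pair (i := r.1) (r := r) (j := j) (k := k) hjk hkl rfl rfl ?_ ?_
    · intro k' hk' i hi
      simp only [chainSeq, List.getElem_ofFn]
      constructor
      · rintro ⟨h1, h2⟩
        obtain rfl : i = r.1 := h.eq_of_proc_eq h1 hj hi
        refine ⟨?_, rfl⟩
        by_contra hne
        rcases Nat.lt_or_gt_of_ne hne with hlt | hlt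
        · exact hj' _ hlt h1
        · exact h2 _ hlt hj
      · rintro ⟨rfl, rfl⟩
        exact ⟨hj, hj'⟩
    · intro k' hk' s hs
      simp only [chainSeq, List.getElem_ofFn]
      constructor
      · rintro ⟨h1, h2⟩
        obtain rfl : s = r := h.oneShot.res_unique h1 hr hs
        exact ⟨congrArg Fin.val (h.strictMono.injective (h2.symm.trans hrk)), rfl⟩
      · rintro ⟨rfl, rfl⟩
        exact ⟨hr, hrk⟩
  -- Both projections are empty: by `complete`, a process without a response has no pair in the
  -- chain.
  · rw [projExec_comp_of_forall_res fun r hr hrp => hp ⟨r, hr, hrp⟩]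
    symm
    apply projSeq_eq_nil
    · intro k hk a ha hap
      simp only [chainSeq, List.getElem_ofFn] at ha
      obtain ⟨r, hr, rfl⟩ := h.complete _ a ha.1
      exact hp ⟨r, hr, hap⟩
    · intro k hk r hr hrp
      simp only [chainSeq, List.getElem_ofFn] at hr
      exact hp ⟨r, hr.1, hrp⟩

/-- The invocation cannot come after level `k`, because its pair is already in `W k`. The lower
bound names a level whose set contains the pair, which is what a missing pair in an earlier
operation's result contradicts. -/
theorem appearsIn_bounds (h : ReturnsChain E W) {r : (wsInterface n V).Res} {k : Fin m}
    (hr : Event.res r ∈ E) (hrk : r.2 = W k) (c : Fin (classes (chainSeq E W)).length)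
    (hc : AppearsIn r ((classes (chainSeq E W)).get c)) :
    c.val ≤ 2 * k.val + 1 ∧ ∃ j : Fin m, r.1 ∈ W j ∧ 2 * j.val ≤ c.val := by
  rcases hc with hc | hc
  · obtain ⟨j, hj, hcj, hjm⟩ := (inv_mem_classes_iff _ _ _ _).1 hc
    simp only [chainSeq, List.getElem_ofFn] at hjm
    have hj' : j < m := by simpa [chainSeq] using hj
    refine ⟨?_, ⟨j, hj'⟩, hjm.1, hcj.ge⟩
    by_contra hlt
    exact hjm.2 k (Fin.lt_def.2 (by simp only; omega)) (hrk ▸ h.self_mem r hr)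
  · obtain ⟨j, hj, hcj, hjm⟩ := (res_mem_classes_iff _ _ _ _).1 hc
    simp only [chainSeq, List.getElem_ofFn] at hjm
    have : k = ⟨j, _⟩ := h.strictMono.injective (hrk.symm.trans hjm.2)
    subst this
    exact ⟨hcj.le, _, hrk ▸ h.self_mem r hr, by simp only; omega⟩

theorem respects (h : ReturnsChain E W) : Respects (chainSeq E W) (comp E) := by
  intro a b ha hb hab c d hc hd
  have hsub : List.Sublist (comp E) E := List.filter_sublist
  obtain ⟨k, hk⟩ := h.exists_eq a (hsub.subset ha.2)
  obtain ⟨k', hk'⟩ := h.exists_eq b (hsub.subset hb.2)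
  have hnot : b.1 ∉ W k := hk ▸ h.not_mem_of_precedes a b (hab.trans hsub)
  obtain ⟨h1, -⟩ := h.appearsIn_bounds (hsub.subset ha.2) hk c hc
  obtain ⟨-, j, hj, h2⟩ := h.appearsIn_bounds (hsub.subset hb.2) hk' d hd
  have hkj : k < j := by
    by_contra hle
    exact hnot (h.strictMono.monotone (not_lt.1 hle) hj)
  have := Fin.lt_def.1 hkj
  exact Fin.lt_def.2 (by omega)

end ReturnsChain

/-! ### Completing an execution -/

/-- The operations that have returned in `E` have returned sets that contain their own pairs, that
contain only pairs invoked before the return, and that are ordered by inclusion. -/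
structure SnapshotReturns (E : List (Event (wsInterface n V))) : Prop where
  oneShot : OneShot E
  self_mem : ∀ r : (wsInterface n V).Res, Event.res r ∈ E → r.1 ∈ r.2
  inv_mem : ∀ r : (wsInterface n V).Res, Event.res r ∈ E → ∀ a ∈ r.2, Event.inv a ∈ E
  chain : IsChain (· ⊆ ·) {S | ∃ r : (wsInterface n V).Res, Event.res r ∈ E ∧ r.2 = S}
  not_mem_of_precedes : ∀ r s : (wsInterface n V).Res, Precedes E r s → s.1 ∉ r.2

/-- A response can be appended only at a process whose projection is a lone invocation, and `hnd`
allows only one there. -/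
theorem OneShot.extension {E : List (Event (wsInterface n V))} (h : OneShot E)
    {L : List (wsInterface n V).Res} (hL : ∀ r ∈ L, Pending E r.1)
    (hnd : (L.map (wsInterface n V).resInv).Nodup) : OneShot (E ++ L.map Event.res) := by
  intro p
  have hproj : ∀ e ∈ projExec (L.map Event.res) p, ∃ r ∈ L, e = Event.res r ∧ r.1.1 = p := by
    intro e he
    obtain ⟨he, hp⟩ := mem_projExec.1 he
    obtain ⟨r, hr, rfl⟩ := List.mem_map.1 he
    exact ⟨r, hr, rfl, hp⟩
  have hpend : ∀ r ∈ L, r.1.1 = p → (Event.inv r.1 : Event (wsInterface n V)) ∈ projExec E p :=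
    fun r hr hp => mem_projExec.2 ⟨(hL r hr).1, hp⟩
  rw [projExec_append]
  rcases h p with h | ⟨x, h⟩ | ⟨x, S, h⟩
  · left
    rw [h, List.nil_append, List.eq_nil_iff_forall_not_mem]
    intro e he
    obtain ⟨r, hr, -, hp⟩ := hproj e he
    simpa [h] using hpend r hr hp
  · right
    rw [h]
    have hnd' : (projExec (L.map (Event.res (𝓘 := wsInterface n V))) p).Nodup := by
      refine List.Nodup.filter _ ((List.Nodup.of_map _ hnd).map ?_)
      intro r s hrs
      cases hrs
      rfl
    have hall : ∀ e ∈ projExec (L.map Event.res) p, ∃ r ∈ L, e = Event.res r ∧ r.1 = (p, x) := by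
      intro e he
      obtain ⟨r, hr, he, hp⟩ := hproj e he
      have := hpend r hr hp
      simp only [h, List.mem_singleton, Event.inv.injEq] at this
      exact ⟨r, hr, he, this⟩
    match hq : projExec (L.map (Event.res (𝓘 := wsInterface n V))) p with
    | [] => exact .inl ⟨x, rfl⟩
    | [e] =>
      obtain ⟨⟨a, S⟩, hr, rfl, rfl⟩ := hall e (by simp [hq])
      exact .inr ⟨x, S, rfl⟩
    | e :: e' :: l =>
      obtain ⟨r, hr, rfl, hx⟩ := hall e (by simp [hq])
      obtain ⟨r', hr', rfl, hx'⟩ := hall e' (by simp [hq])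
      have : r = r' := List.inj_on_of_nodup_map hnd hr hr' (hx.trans hx'.symm)
      subst this
      simp [hq] at hnd'
  · right; right
    refine ⟨x, S, ?_⟩
    rw [h]
    suffices projExec (L.map (Event.res (𝓘 := wsInterface n V))) p = [] by simp [this]
    rw [List.eq_nil_iff_forall_not_mem]
    intro e he
    obtain ⟨r, hr, -, hp⟩ := hproj e he
    have h1 := hpend r hr hp
    have h2 : (Event.res ((p, x), S) : Event (wsInterface n V)) ∈ projExec E p := by simp [h]
    simp only [h, List.mem_cons, Event.inv.injEq, reduceCtorEq, List.not_mem_nil, or_false] at h1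
    exact (hL r hr).2 _ (mem_projExec.1 h2).1 h1.symm

theorem finite_setOf_res_mem (E : List (Event (wsInterface n V))) :
    {r : (wsInterface n V).Res | Event.res r ∈ E}.Finite :=
  (List.finite_toSet E).preimage fun r _ s _ hrs => by cases hrs; rfl

theorem finite_setOf_inv_mem (E : List (Event (wsInterface n V))) :
    {a : (wsInterface n V).Inv | Event.inv a ∈ E}.Finite :=
  (List.finite_toSet E).preimage fun r _ s _ hrs => by cases hrs; rfl

/-- Completing with the union of the chain adds no new returned set, as the union is the largest
member; it contains every pair being completed. -/
theorem SnapshotReturns.exists_returnsChain {E : List (Event (wsInterface n V))}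
    (h : SnapshotReturns E) : ∃ (E' : List (Event (wsInterface n V))) (m : ℕ)
      (W : Fin m → Set (Fin n × V)), IsExtension E E' ∧ ReturnsChain E' W := by
  have hfin : {S | ∃ r : (wsInterface n V).Res, Event.res r ∈ E ∧ r.2 = S}.Finite :=
    (finite_setOf_res_mem E).image Prod.snd
  obtain ⟨m, W, hW, hrange⟩ := exists_strictMono_enumeration hfin h.chain
  have hWres : ∀ k, ∃ r : (wsInterface n V).Res, Event.res r ∈ E ∧ r.2 = W k := fun k =>
    hrange.subset ⟨k, rfl⟩
  have hresW : ∀ r : (wsInterface n V).Res, Event.res r ∈ E → ∃ k, r.2 = W k := fun r hr => by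
    obtain ⟨k, hk⟩ := hrange.superset ⟨r, hr, rfl⟩
    exact ⟨k, hk.symm⟩
  have hpf : {a : (wsInterface n V).Inv | Pending E a ∧ ∃ k, a ∈ W k}.Finite :=
    (finite_setOf_inv_mem E).subset fun a ha => ha.1.1
  let L : List (wsInterface n V).Res := hpf.toFinset.toList.map fun a => (a, ⋃ k, W k)
  have hLmem : ∀ r, r ∈ L ↔ (Pending E r.1 ∧ ∃ k, r.1 ∈ W k) ∧ r.2 = ⋃ k, W k := by
    rintro ⟨a, S⟩
    simp only [L, List.mem_map, Finset.mem_toList, Set.Finite.mem_toFinset, Set.mem_ofPred_eq,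
      Prod.mk.injEq]
    constructor
    · rintro ⟨b, hb, rfl, rfl⟩
      exact ⟨hb, rfl⟩
    · rintro ⟨hb, rfl⟩
      exact ⟨a, hb, rfl, rfl⟩
  have hLpend : ∀ r ∈ L, Pending E r.1 := fun r hr => ((hLmem r).1 hr).1.1
  have hLnd : (L.map (wsInterface n V).resInv).Nodup := by
    simp only [L, List.map_map]
    exact (Finset.nodup_toList _).map fun a b hab => hab
  have hmem : ∀ r : (wsInterface n V).Res,
      Event.res r ∈ E ++ L.map Event.res ↔ Event.res r ∈ E ∨ r ∈ L := by
    intro r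
    simp
  -- The index `k` serves only to show `0 < m`, so that a top set exists.
  have hunion : ∀ k : Fin m, ∃ j, ⋃ k, W k = W j := by
    intro k
    have hk := k.2
    refine ⟨⟨m - 1, by omega⟩, ?_⟩
    refine (Set.iUnion_subset fun i => hW.monotone (Fin.le_def.2 ?_)).antisymm
      (Set.subset_iUnion W _)
    have hi := i.2
    simp only
    omega
  refine ⟨E ++ L.map Event.res, m, W, ⟨L, rfl, hLpend, hLnd⟩, ?_⟩
  refine ⟨h.oneShot.extension hLpend hLnd, hW, ?_, ?_, ?_, ?_, ?_⟩
  · intro k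
    obtain ⟨r, hr, hk⟩ := hWres k
    exact ⟨r, (hmem r).2 (.inl hr), hk⟩
  · intro r hr
    rcases (hmem r).1 hr with hr | hr
    · exact hresW r hr
    · obtain ⟨⟨-, k, -⟩, hU⟩ := (hLmem r).1 hr
      rw [hU]
      exact hunion k
  · intro r hr
    rcases (hmem r).1 hr with hr | hr
    · exact h.self_mem r hr
    · obtain ⟨⟨-, hk⟩, hU⟩ := (hLmem r).1 hr
      rw [hU]
      exact Set.mem_iUnion.2 hk
  · intro k a ha
    obtain ⟨r, hr, hk⟩ := hWres k
    have hinv := h.inv_mem r hr a (hk ▸ ha)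
    -- A pair that was seen belongs to an invoked operation, which either receives an appended
    -- response or already had one.
    by_cases hp : Pending E a
    · exact ⟨(a, ⋃ k, W k), (hmem _).2 (.inr ((hLmem _).2 ⟨⟨hp, k, ha⟩, rfl⟩)), rfl⟩
    · have : ∃ s : (wsInterface n V).Res, Event.res s ∈ E ∧ s.1 = a := by
        by_contra hne
        exact hp ⟨hinv, fun s hs hsa => hne ⟨s, hs, hsa⟩⟩
      obtain ⟨s, hs, hsa⟩ := this
      exact ⟨s, (hmem s).2 (.inl hs), hsa⟩
  · intro r s hrs
    refine h.not_mem_of_precedes r s ?_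
    -- The appended events are all responses. A precedence ends in an invocation, so it lies
    -- entirely inside `E`.
    obtain ⟨l₁, l₂, hl, h1, h2⟩ := List.sublist_append_iff.1 hrs
    have h2' : Event.inv s.1 ∉ l₂ := fun hm => by
      obtain ⟨_, _, he⟩ := List.mem_map.1 (h2.subset hm)
      cases he
    rcases l₂.eq_nil_or_concat with rfl | ⟨l, e, rfl⟩
    · simp only [List.append_nil] at hl
      subst hl
      exact h1
    · have := congrArg List.getLast? hl
      simp at this
      simp [← this] at h2'

theorem SnapshotReturns.intervalLinearizable {E : List (Event (wsInterface n V))}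
    (h : SnapshotReturns E) : IntervalLinearizable (wsObject n V) E := by
  obtain ⟨E', m, W, hE', hW⟩ := h.exists_returnsChain
  exact ⟨E', chainSeq E' W, hE', hW.projSeq_eq, hW.mem_ISSpec, hW.respects⟩

/-! ### The invariant of the algorithm -/

/-- The invariant of the local state of process `i`. The set `H` consists of the contents of the
memory at the instants at which a collect of the loop has started. -/
def LocalInvariant (E : List (Event (wsInterface n V))) (mem : Fin n → Option (Fin n × V))
    (H : Set (Set (Fin n × V))) (i : Fin n) : LocalState n V → Prop
  | .idle => projExec E i = [] ∧ mem i = none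
  | .writing x => projExec E i = [.inv (i, x)] ∧ mem i = none
  | .firstCollect x _ new => projExec E i = [.inv (i, x)] ∧ mem i = some (i, x) ∧
      ∀ a ∈ new, mem a.1 = some a
  | .loopCollect x old todo new => projExec E i = [.inv (i, x)] ∧
      (∀ a ∈ new, mem a.1 = some a) ∧
      ∃ M ∈ H, (i, x) ∈ M ∧ old ⊆ M ∧ ∀ a ∈ M, a.1 ∉ todo → a ∈ new
  | .returning x new => projExec E i = [.inv (i, x)] ∧ (i, x) ∈ new ∧ new ∈ H
  | .done => ∃ x S, projExec E i = [.inv (i, x), .res ((i, x), S)]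

/-- Steps of other processes only enlarge the memory and `H`. Register `i` must stay unchanged
because the states before the write require it to be `⊥`. -/
theorem LocalInvariant.mono {E E' : List (Event (wsInterface n V))}
    {mem mem' : Fin n → Option (Fin n × V)} {H H' : Set (Set (Fin n × V))} {i : Fin n}
    {s : LocalState n V} (h : LocalInvariant E mem H i s) (hE : projExec E' i = projExec E i)
    (hmem : ∀ j a, mem j = some a → mem' j = some a) (hi : mem' i = mem i) (hH : H ⊆ H') :
    LocalInvariant E' mem' H' i s := by
  cases s with
  | idle => exact ⟨hE.trans h.1, hi.trans h.2⟩
  | writing x => exact ⟨hE.trans h.1, hi.trans h.2⟩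
  | firstCollect x todo new =>
    exact ⟨hE.trans h.1, hi.trans h.2.1, fun a ha => hmem _ _ (h.2.2 a ha)⟩
  | loopCollect x old todo new =>
    obtain ⟨h1, h2, M, hM, h3⟩ := h
    exact ⟨hE.trans h1, fun a ha => hmem _ _ (h2 a ha), M, hH hM, h3⟩
  | returning x new => exact ⟨hE.trans h.1, h.2.1, hH h.2.2⟩
  | done =>
    obtain ⟨x, S, h⟩ := h
    exact ⟨x, S, hE.trans h⟩

/-- The invariant of the runs of the algorithm. -/
structure RunInvariant (E : List (Event (wsInterface n V))) (c : Config n V)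
    (H : Set (Set (Fin n × V))) : Prop where
  mem_spec : ∀ j a, c.mem j = some a → a.1 = j ∧ Event.inv a ∈ E
  chain : IsChain (· ⊆ ·) H
  le_mem : ∀ M ∈ H, ∀ a ∈ M, c.mem a.1 = some a
  loc : ∀ i, LocalInvariant E c.mem H i (c.loc i)
  res : ∀ r : (wsInterface n V).Res, Event.res r ∈ E → r.2 ∈ H ∧ r.1 ∈ r.2
  prec : ∀ r s : (wsInterface n V).Res, Precedes E r s → s.1 ∉ r.2

/-! ### Preservation of the invariant along a run -/

namespace RunInvariant

variable {E : List (Event (wsInterface n V))} {c : Config n V} {H : Set (Set (Fin n × V))}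

theorem initial : RunInvariant [] (Config.initial n V) ∅ where
  mem_spec := by simp [Config.initial]
  chain := by simp
  le_mem := by simp
  loc := fun i => ⟨rfl, rfl⟩
  res := by simp
  prec := fun r s h => by simp [Precedes] at h

theorem setLoc (h : RunInvariant E c H) {i : Fin n} {s : LocalState n V}
    (hs : LocalInvariant E c.mem H i s) : RunInvariant E (c.setLoc i s) H where
  mem_spec := h.mem_spec
  chain := h.chain
  le_mem := h.le_mem
  loc := fun j => by
    by_cases hj : j = i
    · subst hj
      simpa [Config.setLoc] using hs
    · simpa [Config.setLoc, hj] using h.loc j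
  res := h.res
  prec := h.prec

/-- The current memory contents contain every earlier recorded set, so recording them extends the
chain at the top. This is applied whenever a loop collect starts. -/
theorem insert_mem (h : RunInvariant E c H) :
    RunInvariant E c (insert {a | c.mem a.1 = some a} H) where
  mem_spec := h.mem_spec
  chain := h.chain.insert fun M hM _ => .inr (h.le_mem M hM)
  le_mem := by
    rintro M (rfl | hM) a ha
    · exact ha
    · exact h.le_mem M hM a ha
  loc := fun i => (h.loc i).mono rfl (fun _ _ => id) rfl (Set.subset_insert _ _)
  res := fun r hr => ⟨Or.inr (h.res r hr).1, (h.res r hr).2⟩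
  prec := h.prec

theorem mem_of_mem (h : RunInvariant E c H) {j : Fin n} {a : Fin n × V}
    (ha : c.mem j = some a) : c.mem a.1 = some a := by
  rw [(h.mem_spec j a ha).1, ha]

/-- Register `i` is still `⊥` before the write, so nothing is overwritten and the memory grows. -/
theorem write (h : RunInvariant E c H) {i : Fin n} {x : V} (hi : c.loc i = .writing x) :
    RunInvariant E ((c.write i (i, x)).setLoc i (.firstCollect x Finset.univ ∅)) H := by
  have hloc := h.loc i
  rw [hi] at hloc
  obtain ⟨hp, hnone⟩ := hloc
  have hmono : ∀ j a, c.mem j = some a → (c.write i (i, x)).mem j = some a := by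
    intro j a ha
    have : j ≠ i := by
      rintro rfl
      simp [hnone] at ha
    simpa [Config.write, this] using ha
  constructor
  · intro j a ha
    by_cases hj : j = i
    · subst hj
      have : a = (j, x) := by simpa [Config.write, Config.setLoc, eq_comm] using ha
      subst this
      have : (Event.inv (j, x) : Event (wsInterface n V)) ∈ projExec E j := by simp [hp]
      exact ⟨rfl, (mem_projExec.1 this).1⟩
    · exact h.mem_spec j a (by simpa [Config.write, Config.setLoc, hj] using ha)
  · exact h.chain
  · exact fun M hM a ha => hmono _ _ (h.le_mem M hM a ha)
  · intro j
    by_cases hj : j = i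
    · subst hj
      have : ((c.write j (j, x)).setLoc j (.firstCollect x Finset.univ ∅)).loc j =
        .firstCollect x Finset.univ ∅ := by simp [Config.setLoc]
      rw [this]
      exact ⟨hp, by simp [Config.write, Config.setLoc], by simp⟩
    · have : ((c.write i (i, x)).setLoc i (.firstCollect x Finset.univ ∅)).loc j = c.loc j := by
        simp [Config.setLoc, Config.write, hj]
      rw [this]
      exact (h.loc j).mono rfl hmono (by simp [Config.write, Config.setLoc, hj]) le_rfl
  · exact h.res
  · exact h.prec

/-- Appending an event of a process `i` and changing the local state of `i`. -/
theorem append_event (h : RunInvariant E c H) {i : Fin n} {s : LocalState n V}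
    {e : Event (wsInterface n V)} (he : e.proc = i)
    (hs : LocalInvariant (E ++ [e]) c.mem H i s)
    (hres : ∀ r : (wsInterface n V).Res, e = .res r → r.2 ∈ H ∧ r.1 ∈ r.2)
    (hinv : ∀ a : (wsInterface n V).Inv, e = .inv a → c.mem i = none) :
    RunInvariant (E ++ [e]) (c.setLoc i s) H := by
  constructor
  · exact fun j a ha => ⟨(h.mem_spec j a ha).1, List.mem_append_left _ (h.mem_spec j a ha).2⟩
  · exact h.chain
  · exact h.le_mem
  · intro j
    by_cases hj : j = i
    · subst hj
      simpa [Config.setLoc] using hs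
    · have : (c.setLoc i s).loc j = c.loc j := by simp [Config.setLoc, hj]
      rw [this]
      refine (h.loc j).mono ?_ (fun _ _ => id) rfl le_rfl
      rw [projExec_append, projExec_singleton_of_ne (by rw [he]; exact Ne.symm hj),
        List.append_nil]
  · intro r hr
    rcases List.mem_append.1 hr with hr | hr
    · exact h.res r hr
    · exact hres r (List.mem_singleton.1 hr).symm
  · intro r t hrt
    obtain ⟨l₁, l₂, hl, h1, h2⟩ := List.sublist_append_iff.1 hrt
    rcases List.sublist_singleton.1 h2 with rfl | rfl
    · rw [List.append_nil] at hl
      subst hl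
      exact h.prec r t h1
    -- Here the new event is the invocation of `t`. Its register is still `⊥`, whereas a pair in the
    -- set returned by `r` would already be in memory.
    · obtain ⟨hl1, hl2⟩ := List.append_inj' (s₁ := [Event.res r]) (t₁ := [Event.inv t.1])
        hl rfl
      subst hl1
      have hr : Event.res r ∈ E := h1.subset (by simp)
      have het : e = Event.inv t.1 := by simpa using hl2.symm
      intro ht
      have h3 := h.le_mem _ (h.res r hr).1 _ ht
      have h4 := hinv t.1 het
      rw [← he, het] at h4
      exact absurd (h3.symm.trans h4) (by simp)

theorem step (h : RunInvariant E c H) {c' : Config n V} {e : Option (Event (wsInterface n V))}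
    (hs : Step c e c') : ∃ H', RunInvariant (E ++ e.toList) c' H' := by
  cases hs with
  | invoke i x hi =>
    have hl := h.loc i
    rw [hi] at hl
    refine ⟨H, h.append_event rfl ⟨?_, hl.2⟩ (by simp) fun _ _ => hl.2⟩
    rw [projExec_append, hl.1]
    exact projExec_singleton_self _
  | write i x hi =>
    simp only [Option.toList_none, List.append_nil]
    exact ⟨H, h.write hi⟩
  | firstRead i x todo new j hi hj =>
    have hl := h.loc i
    rw [hi] at hl
    simp only [Option.toList_none, List.append_nil]
    refine ⟨H, h.setLoc ⟨hl.1, hl.2.1, ?_⟩⟩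
    rintro a (ha | ha)
    · exact hl.2.2 a ha
    · exact h.mem_of_mem ha
  | enterLoop i x new hi =>
    have hl := h.loc i
    rw [hi] at hl
    simp only [Option.toList_none, List.append_nil]
    -- The witness `M` is the current memory: it contains the own pair, already written, and
    -- everything the first collect has read.
    exact ⟨_, h.insert_mem.setLoc ⟨hl.1, by simp, _, Set.mem_insert _ _, hl.2.1, hl.2.2,
      by simp⟩⟩
  | loopRead i x old todo new j hi hj =>
    have hl := h.loc i
    rw [hi] at hl
    obtain ⟨hp, hnew, M, hM, hix, hold, hread⟩ := hl
    simp only [Option.toList_none, List.append_nil]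
    refine ⟨H, h.setLoc ⟨hp, ?_, M, hM, hix, hold, ?_⟩⟩
    · rintro a (ha | ha)
      · exact hnew a ha
      · exact h.mem_of_mem ha
    · intro a ha hat
      -- If `a` belongs to register `j`, it was there when the collect started and is still there,
      -- so this read finds it.
      by_cases haj : a.1 = j
      · exact .inr (haj ▸ h.le_mem M hM a ha)
      · exact .inl (hread a ha fun hm => hat (Finset.mem_erase.2 ⟨haj, hm⟩))
  | repeatLoop i x old new hi hne =>
    have hl := h.loc i
    rw [hi] at hl
    obtain ⟨hp, hnew, M, hM, hix, hold, hread⟩ := hl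
    simp only [Option.toList_none, List.append_nil]
    exact ⟨_, h.insert_mem.setLoc ⟨hp, by simp, _, Set.mem_insert _ _, h.le_mem M hM _ hix, hnew,
      by simp⟩⟩
  | exitLoop i x old new hi heq =>
    have hl := h.loc i
    rw [hi] at hl
    obtain ⟨hp, hnew, M, hM, hix, hold, hread⟩ := hl
    subst heq
    -- The double collect: with no register left to read, `M ⊆ new = old ⊆ M`, so the set to be
    -- returned is the recorded memory contents `M`.
    obtain rfl : old = M := hold.antisymm fun a ha => hread a ha (by simp)
    simp only [Option.toList_none, List.append_nil]
    exact ⟨H, h.setLoc ⟨hp, hix, hM⟩⟩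
  | respond i x new hi =>
    have hl := h.loc i
    rw [hi] at hl
    obtain ⟨hp, hix, hH⟩ := hl
    refine ⟨H, h.append_event rfl ⟨x, new, ?_⟩ ?_ (by simp)⟩
    · rw [projExec_append, hp]
      exact congrArg _ (projExec_singleton_self (𝓘 := wsInterface n V) (.res ((i, x), new)))
    · intro r hr
      cases hr
      exact ⟨hH, hix⟩

theorem exists_of_run (h : Run E c) : ∃ H, RunInvariant E c H := by
  induction h with
  | start => exact ⟨∅, initial⟩
  | step _ hs ih =>
    obtain ⟨H, hH⟩ := ih
    exact hH.step hs

theorem oneShot (h : RunInvariant E c H) : OneShot E := by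
  intro p
  have hl := h.loc p
  cases hs : c.loc p <;> rw [hs] at hl
  · exact .inl hl.1
  · exact .inr (.inl ⟨_, hl.1⟩)
  · exact .inr (.inl ⟨_, hl.1⟩)
  · exact .inr (.inl ⟨_, hl.1⟩)
  · exact .inr (.inl ⟨_, hl.1⟩)
  · exact .inr (.inr hl)

theorem snapshotReturns (h : RunInvariant E c H) : SnapshotReturns E where
  oneShot := h.oneShot
  self_mem := fun r hr => (h.res r hr).2
  inv_mem := fun r hr a ha => (h.mem_spec _ a (h.le_mem _ (h.res r hr).1 a ha)).2
  chain := h.chain.mono fun S hS => by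
    obtain ⟨r, hr, rfl⟩ := hS
    exact (h.res r hr).1
  not_mem_of_precedes := h.prec

end RunInvariant

end WriteSnapshot

end IntervalLin

theorem theorem1 (n : ℕ) (V : Type*) (E : List (IntervalLin.Event (IntervalLin.wsInterface n V)))
    (hE : IntervalLin.IsExecution n V E) :
    IntervalLin.IntervalLinearizable (IntervalLin.wsObject n V) E := by
  obtain ⟨c, hc⟩ := hE
  obtain ⟨H, hH⟩ := IntervalLin.RunInvariant.exists_of_run hc
  exact hH.snapshotReturns.intervalLinearizable
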